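/- Let $n\ge 0$, let $\mathbb P^n$ be a smooth $n$-dimensional Riemannian manifold with metric $g$, let $I\subseteq\mathbb R$ be an open interval and $\rho:I\to(0,\infty)$ a smooth function. Let $\overline M^{n+1}=I\times_\rho\mathbb P^n$ be the warped product, i.e. $I\times\mathbb P$ with the metric $dt^2+\rho(t)^2 g$, and let $\partial_t$ be its unit vector field tangent to the factor $I$. Let $M^n$ be a connected (immersed) smooth hypersurface of $\overline M$, given by an immersion $\varphi:M\to\overline M$, and suppose that $M$ is orientable in the sense that it carries a smooth unit normal vector field $\xi$. We say that $M$ is a *constant angle hypersurface with angle* $\theta$ if, for a suitable choice of $\xi$, the angle between $\partial_t$ and $\xi$ equals $\theta$ at every point of $M$; and that $M$ is a *constant angle hypersurface* if this holds for some $\theta$. (Replacing $\xi$ by $-\xi$ one may take $\theta\in[0,\pi/2]$.) Consider the following two conditions on $M$. * (Cyl) $M$ is locally an open subset of a cylinder: every point of $M$ has an open neighbourhood in $M$ which $\varphi$ maps injectively onto an open subset of a cylinder $I\times L$, where $L$ is a smooth (embedded) hypersurface of $\mathbb P$. * (Gr$_C$), for a constant $C$: $M$ is locally the graph of a solution of the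 generalized eikonal equation: every point of $M$ has an open neighbourhood in $M$ which $\varphi$ maps injectively onto the graph $\{(f(p),p): p\in\Omega\}$ of a smooth function $f:\Omega\to I$ on an open set $\Omega\subseteq\mathbb P$ with $$|\nabla f| = C\cdot(\rho\circ f)\quad\text{on }\Omega,$$ where $\nabla f$ and $|\cdot|$ are taken with respect to $g$. The constant $C$ is the same for all points of $M$. Then: 1. $M$ is a constant angle hypersurface if and only if (Cyl) holds or (Gr$_C$) holds for some constant $C$. 2. $M$ is a constant angle hypersurface with angle $\pi/2$ if and only if (Cyl) holds. 3. For every $\theta\in[0,\pi/2)$, $M$ is a constant angle hypersurface with angle $\theta$ if and only if (Gr$_C$) holds with $C=\tan\theta$. -/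

import Mathlib

open Set Bundle
open scoped Manifold ContDiff Bundle

noncomputable section

namespace WarpedProduct

/-- `ℝⁿ` with its Euclidean norm, the model space of `n`-dimensional manifolds. -/
abbrev Model (n : ℕ) : Type := EuclideanSpace ℝ (Fin n)

section Ambient

variable {n : ℕ} {P : Type*} [TopologicalSpace P] [ChartedSpace (Model n) P]

/-- The tangent space of `ℝ × P` at `x`. It is `ℝ × T_p P` for `x = (t, p)`. -/
abbrev TangentAmbient (n : ℕ) {P : Type*} [TopologicalSpace P] [ChartedSpace (Model n) P]
    (x : ℝ × P) : Type :=
  TangentSpace (𝓘(ℝ, ℝ).prod 𝓘(ℝ, Model n)) x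

/-- The `ℝ`-component `a` of a tangent vector `(a, v)` at `(t, p)`. -/
def timePart {x : ℝ × P} (w : TangentAmbient n x) : ℝ :=
  (show ℝ × Model n from w).1

/-- The component `v ∈ T_p P` of a tangent vector `(a, v)` at `(t, p)`. -/
def spacePart {x : ℝ × P} (w : TangentAmbient n x) : TangentSpace 𝓘(ℝ, Model n) x.2 :=
  (show ℝ × Model n from w).2

/-- The coordinate vector field `∂_t`, with value `(1, 0)` at every point. -/
def partialT (x : ℝ × P) : TangentAmbient n x :=
  (show ℝ × Model n from (1, 0))

variable [RiemannianBundle (fun p : P ↦ TangentSpace 𝓘(ℝ, Model n) p)]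

/-- The warped product metric `dt² + ρ(t)² g_P` at the point `x = (t, p)`. -/
def warpedInner (ρ : ℝ → ℝ) (x : ℝ × P) (v w : TangentAmbient n x) : ℝ :=
  timePart v * timePart w + ρ x.1 ^ 2 * inner ℝ (spacePart v) (spacePart w)

/-- The length of a tangent vector in the warped product metric. -/
def warpedNorm (ρ : ℝ → ℝ) (x : ℝ × P) (v : TangentAmbient n x) : ℝ :=
  Real.sqrt (warpedInner ρ x v v)

/-- The angle in `[0, π]` between two tangent vectors in the warped product metric. -/
def warpedAngle (ρ : ℝ → ℝ) (x : ℝ × P) (v w : TangentAmbient n x) : ℝ :=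
  Real.arccos (warpedInner ρ x v w / (warpedNorm ρ x v * warpedNorm ρ x w))

end Ambient

section Base

variable {n : ℕ} {P : Type*} [TopologicalSpace P] [ChartedSpace (Model n) P]

/-- `L ⊆ P` is a smooth (embedded) hypersurface: near each of its points it is the zero set of a
smooth real function without critical points. -/
def IsHypersurface (n : ℕ) {P : Type*} [TopologicalSpace P] [ChartedSpace (Model n) P]
    (L : Set P) : Prop :=
  ∀ p ∈ L, ∃ (V : Set P) (g : P → ℝ), IsOpen V ∧ p ∈ V ∧
    ContMDiffOn 𝓘(ℝ, Model n) 𝓘(ℝ, ℝ) ∞ g V ∧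
    (∀ q ∈ V, mfderiv 𝓘(ℝ, Model n) 𝓘(ℝ, ℝ) g q ≠ 0) ∧
    L ∩ V = {q ∈ V | g q = 0}

variable [RiemannianBundle (fun p : P ↦ TangentSpace 𝓘(ℝ, Model n) p)]

instance instFiniteDimensionalTangent (p : P) : FiniteDimensional ℝ (TangentSpace 𝓘(ℝ, Model n) p) :=
  inferInstanceAs (FiniteDimensional ℝ (Model n))

instance instCompleteSpaceTangent (p : P) : CompleteSpace (TangentSpace 𝓘(ℝ, Model n) p) :=
  FiniteDimensional.complete ℝ _

/-- The Riemannian gradient `∇f(p) ∈ T_p P`, i.e. the vector with `⟨∇f(p), v⟩ = df_p(v)`. -/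
def grad (n : ℕ) {P : Type*} [TopologicalSpace P] [ChartedSpace (Model n) P]
    [RiemannianBundle (fun p : P ↦ TangentSpace 𝓘(ℝ, Model n) p)]
    (f : P → ℝ) (p : P) : TangentSpace 𝓘(ℝ, Model n) p :=
  (InnerProductSpace.toDual ℝ (TangentSpace 𝓘(ℝ, Model n) p)).symm
    (mfderiv 𝓘(ℝ, Model n) 𝓘(ℝ, ℝ) f p)

theorem inner_grad (f : P → ℝ) (p : P) (v : TangentSpace 𝓘(ℝ, Model n) p) :
    inner ℝ (grad n f p) v = mfderiv 𝓘(ℝ, Model n) 𝓘(ℝ, ℝ) f p v :=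
  InnerProductSpace.toDual_symm_apply

/-- `f : Ω → I` is transnormal: it is smooth and satisfies the generalized eikonal equation
`|∇f| = C · (ρ ∘ f)`. The values of `f` outside `Ω` play no role. -/
structure IsTransnormalOn (n : ℕ) {P : Type*} [TopologicalSpace P] [ChartedSpace (Model n) P]
    [RiemannianBundle (fun p : P ↦ TangentSpace 𝓘(ℝ, Model n) p)]
    (I : Set ℝ) (ρ : ℝ → ℝ) (C : ℝ) (Ω : Set P) (f : P → ℝ) : Prop where
  smooth : ContMDiffOn 𝓘(ℝ, Model n) 𝓘(ℝ, ℝ) ∞ f Ω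
  mapsTo : MapsTo f Ω I
  eikonal : ∀ p ∈ Ω, ‖grad n f p‖ = C * ρ (f p)

end Base

section Hypersurface

variable {n : ℕ} {P : Type*} [TopologicalSpace P] [ChartedSpace (Model n) P]
  {M : Type*} [TopologicalSpace M] [ChartedSpace (Model n) M]

/-- The smooth map `φ : M → ℝ × P` from an `n`-manifold is an immersion with values in `I × P`,
so that it presents `M` as a hypersurface of `I × P`. -/
structure IsImmersedHypersurface (n : ℕ) {P : Type*} [TopologicalSpace P]
    [ChartedSpace (Model n) P] {M : Type*} [TopologicalSpace M] [ChartedSpace (Model n) M]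
    (I : Set ℝ) (φ : M → ℝ × P) : Prop where
  smooth : ContMDiff 𝓘(ℝ, Model n) (𝓘(ℝ, ℝ).prod 𝓘(ℝ, Model n)) ∞ φ
  injective_mfderiv : ∀ x, Function.Injective
    (mfderiv 𝓘(ℝ, Model n) (𝓘(ℝ, ℝ).prod 𝓘(ℝ, Model n)) φ x)
  mem : ∀ x, (φ x).1 ∈ I

/-- Every point of `M` has an open neighbourhood that `φ` maps injectively onto an open subset of a
cylinder `I × L` over a hypersurface `L` of `P`. -/
def IsLocallyCylinder (n : ℕ) {P : Type*} [TopologicalSpace P] [ChartedSpace (Model n) P]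
    {M : Type*} [TopologicalSpace M] (I : Set ℝ) (φ : M → ℝ × P) : Prop :=
  ∀ x : M, ∃ (U : Set M) (L : Set P) (W : Set (ℝ × P)),
    IsOpen U ∧ x ∈ U ∧ InjOn φ U ∧ IsHypersurface n L ∧ IsOpen W ∧ φ '' U = W ∩ (I ×ˢ L)

variable [RiemannianBundle (fun p : P ↦ TangentSpace 𝓘(ℝ, Model n) p)]

/-- Every point of `M` has an open neighbourhood that `φ` maps injectively onto the graph
`{(f(p), p) : p ∈ Ω}` of a function `f : Ω → I` on an open set `Ω ⊆ P` with
`|∇f| = C · (ρ ∘ f)`. The constant `C` is the same for all points of `M`. -/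
def IsLocallyTransnormalGraph (n : ℕ) {P : Type*} [TopologicalSpace P]
    [ChartedSpace (Model n) P] [RiemannianBundle (fun p : P ↦ TangentSpace 𝓘(ℝ, Model n) p)]
    {M : Type*} [TopologicalSpace M] (I : Set ℝ) (ρ : ℝ → ℝ) (C : ℝ) (φ : M → ℝ × P) : Prop :=
  ∀ x : M, ∃ (U : Set M) (Ω : Set P) (f : P → ℝ),
    IsOpen U ∧ x ∈ U ∧ InjOn φ U ∧ IsOpen Ω ∧ IsTransnormalOn n I ρ C Ω f ∧
    φ '' U = (fun p ↦ (f p, p)) '' Ω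

variable [IsManifold 𝓘(ℝ, Model n) ∞ P]

/-- `ξ` is a smooth unit normal vector field along the hypersurface `φ : M → I ×_ρ P`. -/
structure IsUnitNormalField (ρ : ℝ → ℝ) (φ : M → ℝ × P)
    (ξ : ∀ x : M, TangentAmbient n (φ x)) : Prop where
  smooth : ContMDiff 𝓘(ℝ, Model n) (𝓘(ℝ, ℝ).prod 𝓘(ℝ, Model n)).tangent ∞
    (fun x ↦ (⟨φ x, ξ x⟩ : TangentBundle (𝓘(ℝ, ℝ).prod 𝓘(ℝ, Model n)) (ℝ × P)))
  normal : ∀ (x : M) (v : TangentSpace 𝓘(ℝ, Model n) x),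
    warpedInner ρ (φ x) (mfderiv 𝓘(ℝ, Model n) (𝓘(ℝ, ℝ).prod 𝓘(ℝ, Model n)) φ x v) (ξ x) = 0
  unit : ∀ x, warpedNorm ρ (φ x) (ξ x) = 1

/-- The hypersurface is orientable, in the sense that it carries a smooth unit normal field. -/
def IsOrientableHypersurface (n : ℕ) {P : Type*} [TopologicalSpace P] [ChartedSpace (Model n) P]
    [IsManifold 𝓘(ℝ, Model n) ∞ P]
    [RiemannianBundle (fun p : P ↦ TangentSpace 𝓘(ℝ, Model n) p)]
    {M : Type*} [TopologicalSpace M] [ChartedSpace (Model n) M]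
    (ρ : ℝ → ℝ) (φ : M → ℝ × P) : Prop :=
  ∃ ξ : ∀ x : M, TangentAmbient n (φ x), IsUnitNormalField ρ φ ξ

/-- For a suitable choice of the smooth unit normal field `ξ`, the angle between `∂_t` and `ξ` is
equal to `θ` at every point of the hypersurface. -/
def HasConstantAngle (n : ℕ) {P : Type*} [TopologicalSpace P] [ChartedSpace (Model n) P]
    [IsManifold 𝓘(ℝ, Model n) ∞ P]
    [RiemannianBundle (fun p : P ↦ TangentSpace 𝓘(ℝ, Model n) p)]
    {M : Type*} [TopologicalSpace M] [ChartedSpace (Model n) M]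
    (ρ : ℝ → ℝ) (φ : M → ℝ × P) (θ : ℝ) : Prop :=
  ∃ ξ : ∀ x : M, TangentAmbient n (φ x), IsUnitNormalField ρ φ ξ ∧
    ∀ x, warpedAngle ρ (φ x) (partialT (φ x)) (ξ x) = θ

/-- A constant angle hypersurface: the angle between `∂_t` and the unit normal is constant. -/
def IsConstantAngleHypersurface (n : ℕ) {P : Type*} [TopologicalSpace P]
    [ChartedSpace (Model n) P] [IsManifold 𝓘(ℝ, Model n) ∞ P]
    [RiemannianBundle (fun p : P ↦ TangentSpace 𝓘(ℝ, Model n) p)]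
    {M : Type*} [TopologicalSpace M] [ChartedSpace (Model n) M]
    (ρ : ℝ → ℝ) (φ : M → ℝ × P) : Prop :=
  ∃ θ : ℝ, HasConstantAngle n ρ φ θ

end Hypersurface

end WarpedProduct

end

/-! Write `ξ = (τ, ζ)` for the unit normal. Since `∂_t` is a unit vector, the angle is `θ ∈ [0, π]`
exactly when `τ = cos θ`. The tangent hyperplane of `M` is the kernel of the covector `(a, w) ↦ τ a
+ ρ² ⟨ζ, w⟩`, so everything depends on whether `τ` vanishes.

If `τ = 0`, the vertical vector `(1, 0)` is tangent to `M` everywhere. In a chart of `P`, `M` is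
locally the graph of one coordinate over `t` and the remaining coordinates. This function does not
depend on `t`, so `M` is locally a cylinder (`IsImmersedHypersurface.exists_isLocallyCylinder`).
Conversely, a cylinder has vertical tangent vectors, which forces `τ = 0`.

If `τ ≠ 0`, the projection `M → P` is a local diffeomorphism and `M` is locally a graph `t = f(p)`,
for which `τ² (ρ² + |∇f|²) = ρ²` (`IsUnitNormalField.timePart_sq_of_graph`). With `τ = cos θ` this
says `|∇f| = tan θ · ρ`. Conversely, the eikonal equation determines `τ²`, and connectedness of `M`
fixes the sign of `τ`. -/

/-! ### The smooth inverse function theorem. -/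

section InverseFunction

variable {E : Type*} [NormedAddCommGroup E] [NormedSpace ℝ E]
  {M : Type*} [TopologicalSpace M] [ChartedSpace E M]
  {N : Type*} [TopologicalSpace N] [ChartedSpace E N]

/-- Invertible operators form an open set, so the source can be shrunk until the derivative is
invertible at each of its points; this makes the inverse smooth on the whole target and not only at
`g a`. -/
theorem ContDiffOn.exists_openPartialHomeomorph [FiniteDimensional ℝ E]
    {g : E → E} {O : Set E} {a : E} (hO : IsOpen O)
    (ha : a ∈ O) (hg : ContDiffOn ℝ ∞ g O) (hinj : Function.Injective (fderiv ℝ g a)) :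
    ∃ e : OpenPartialHomeomorph E E, a ∈ e.source ∧ e.source ⊆ O ∧ (∀ z, e z = g z) ∧
      ContDiffOn ℝ ∞ e.symm e.target := by
  let A : E ≃L[ℝ] E :=
    (LinearEquiv.ofInjectiveEndo (fderiv ℝ g a : E →ₗ[ℝ] E) hinj).toContinuousLinearEquiv
  have hA : (A : E →L[ℝ] E) = fderiv ℝ g a := by ext v; rfl
  have hga : ContDiffAt ℝ ∞ g a := hg.contDiffAt (hO.mem_nhds ha)
  have hd : HasFDerivAt g (A : E →L[ℝ] E) a := by
    rw [hA]; exact (hga.differentiableAt (by simp)).hasFDerivAt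
  let e₀ := hga.toOpenPartialHomeomorph g hd (by simp)
  let R : Set (E →L[ℝ] E) := range ((↑) : (E ≃L[ℝ] E) → E →L[ℝ] E)
  have hR : IsOpen R := ContinuousLinearEquiv.isOpen
  have hO' : IsOpen (O ∩ fderiv ℝ g ⁻¹' R) :=
    (hg.continuousOn_fderiv_of_isOpen hO (by simp)).isOpen_inter_preimage hO hR
  refine ⟨e₀.restrOpen _ hO', ?_, ?_, fun z => rfl, ?_⟩
  · exact ⟨hga.mem_toOpenPartialHomeomorph_source hd (by simp), ha, A, hA⟩
  · exact fun z hz => hz.2.1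
  · intro w hw
    have hz := (e₀.restrOpen _ hO').map_target hw
    obtain ⟨-, hzO, B, hB⟩ := hz
    refine ContDiffAt.contDiffWithinAt ?_
    have hgz : ContDiffAt ℝ ∞ g ((e₀.restrOpen _ hO').symm w) := hg.contDiffAt (hO.mem_nhds hzO)
    refine (e₀.restrOpen _ hO').contDiffAt_symm (f₀' := B) hw ?_ hgz
    rw [hB]
    exact (hgz.differentiableAt (by simp)).hasFDerivAt

/-- The inverse function theorem for smooth maps between manifolds without boundary. -/
theorem ContMDiffOn.exists_openPartialHomeomorph [FiniteDimensional ℝ E]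
    [IsManifold 𝓘(ℝ, E) ∞ M] [IsManifold 𝓘(ℝ, E) ∞ N] {G : M → N} {U : Set M} {x : M} (hU : IsOpen U)
    (hx : x ∈ U) (hG : ContMDiffOn 𝓘(ℝ, E) 𝓘(ℝ, E) ∞ G U)
    (hinj : Function.Injective (mfderiv 𝓘(ℝ, E) 𝓘(ℝ, E) G x)) :
    ∃ e : OpenPartialHomeomorph M N, x ∈ e.source ∧ e.source ⊆ U ∧ EqOn e G e.source ∧
      ContMDiffOn 𝓘(ℝ, E) 𝓘(ℝ, E) ∞ e.symm e.target := by
  let c := chartAt E x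
  let d := chartAt E (G x)
  let O : Set E := c.target ∩ c.symm ⁻¹' (U ∩ G ⁻¹' d.source)
  have hUd : IsOpen (U ∩ G ⁻¹' d.source) :=
    hG.continuousOn.isOpen_inter_preimage hU d.open_source
  have hO : IsOpen O := c.isOpen_inter_preimage_symm hUd
  have hg : ContDiffOn ℝ ∞ (d ∘ G ∘ c.symm) O := by
    rw [← contMDiffOn_iff_contDiffOn]
    refine (contMDiffOn_chart (x := G x)).comp (hG.comp
      ((contMDiffOn_chart_symm (x := x)).mono inter_subset_left) fun z hz => hz.2.1)
      fun z hz => hz.2.2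
  have hxc : c.symm (c x) = x := c.left_inv (mem_chart_source E x)
  have hcx : c x ∈ O := by
    refine ⟨mem_chart_target E x, ?_⟩
    rw [mem_preimage, hxc]
    exact ⟨hx, mem_chart_source E (G x)⟩
  have hmd : MDifferentiableAt 𝓘(ℝ, E) 𝓘(ℝ, E) G x :=
    (hG.contMDiffAt (hU.mem_nhds hx)).mdifferentiableAt (by simp)
  have hinj' : Function.Injective (fderiv ℝ (d ∘ G ∘ c.symm) (c x)) := by
    have : mfderiv 𝓘(ℝ, E) 𝓘(ℝ, E) G x = fderiv ℝ (d ∘ G ∘ c.symm) (c x) := by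
      refine hmd.mfderiv.trans ?_
      change fderivWithin ℝ (d ∘ G ∘ c.symm) (range id) (c x) = _
      rw [range_id, fderivWithin_univ]
    rw [this] at hinj
    exact hinj
  obtain ⟨e, hae, heO, heg, hesymm⟩ := hg.exists_openPartialHomeomorph hO hcx hinj'
  have key : ∀ y ∈ (c.trans (e.trans d.symm)).source,
      y ∈ c.source ∧ c y ∈ O ∧ (c.trans (e.trans d.symm)) y = G y := by
    intro y hy
    have hy' : y ∈ c.source ∧ c y ∈ e.source := by
      simp only [OpenPartialHomeomorph.trans_source, mem_inter_iff, mem_preimage] at hy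
      exact ⟨hy.1, hy.2.1⟩
    have hyO := heO hy'.2
    refine ⟨hy'.1, hyO, ?_⟩
    have h1 : c.symm (c y) = y := c.left_inv hy'.1
    have h2 := hyO.2.2
    simp only [mem_preimage, h1] at h2
    simp only [OpenPartialHomeomorph.coe_trans, Function.comp_apply, heg, h1]
    exact d.left_inv h2
  refine ⟨c.trans (e.trans d.symm), ?_, ?_, fun y hy => (key y hy).2.2, ?_⟩
  · simp only [OpenPartialHomeomorph.trans_source, mem_inter_iff, mem_preimage]
    refine ⟨mem_chart_source E x, hae, ?_⟩
    rw [heg]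
    simp only [Function.comp_apply, hxc]
    exact d.map_source (mem_chart_source E (G x))
  · intro y hy
    obtain ⟨h1, h2, -⟩ := key y hy
    have := h2.2.1
    rwa [c.left_inv h1] at this
  · have h1 := (contMDiffOn_chart_symm (I := 𝓘(ℝ, E)) (n := ∞) (x := x))
    have h2 := contMDiffOn_iff_contDiffOn.2 hesymm
    have h3 := (contMDiffOn_chart (I := 𝓘(ℝ, E)) (n := ∞) (x := G x))
    have hsub : ∀ w ∈ (c.trans (e.trans d.symm)).target,
        w ∈ d.source ∧ d w ∈ e.target ∧ e.symm (d w) ∈ c.target := by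
      intro w hw
      simp only [OpenPartialHomeomorph.trans_target, OpenPartialHomeomorph.coe_trans_symm,
        OpenPartialHomeomorph.symm_target, OpenPartialHomeomorph.symm_symm,
        mem_inter_iff, mem_preimage, Function.comp_apply] at hw
      exact ⟨hw.1.1, hw.1.2, hw.2⟩
    exact (h1.comp (h2.comp (h3.mono fun w hw => (hsub w hw).1) fun w hw => (hsub w hw).2.1)
      fun w hw => (hsub w hw).2.2)

end InverseFunction

/-- The range of `A` lies in `ker l`, and both have dimension `dim V`. -/
theorem LinearMap.exists_apply_eq_of_finrank_eq_succ {V W : Type*} [AddCommGroup V] [Module ℝ V]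
    [AddCommGroup W] [Module ℝ W] [FiniteDimensional ℝ V] [FiniteDimensional ℝ W]
    (hVW : Module.finrank ℝ W = Module.finrank ℝ V + 1) {A : V →ₗ[ℝ] W}
    (hA : Function.Injective A) {l : W →ₗ[ℝ] ℝ} (hl : l ≠ 0) (hlA : ∀ v, l (A v) = 0)
    {w : W} (hw : l w = 0) : ∃ v, A v = w := by
  have h1 : LinearMap.range A ≤ LinearMap.ker l := by
    rintro _ ⟨v, rfl⟩
    exact hlA v
  have h2 : Module.finrank ℝ (LinearMap.range A) = Module.finrank ℝ V :=
    LinearMap.finrank_range_of_inj hA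
  have h3 := Module.Dual.finrank_ker_add_one_of_ne_zero (f := l) hl
  have h4 := Submodule.eq_of_le_of_finrank_eq h1 (by omega)
  have : w ∈ LinearMap.range A := h4 ▸ hw
  exact this

namespace WarpedProduct

/-! ### Tangent hyperplanes of the immersion. -/

section Immersion

variable {n : ℕ} {P : Type*} [TopologicalSpace P] [ChartedSpace (Model n) P]
  {M : Type*} [TopologicalSpace M] [ChartedSpace (Model n) M] {I : Set ℝ} {φ : M → ℝ × P}

theorem IsImmersedHypersurface.contMDiff_fst (hφ : IsImmersedHypersurface n I φ) :
    ContMDiff 𝓘(ℝ, Model n) 𝓘(ℝ, ℝ) ∞ (fun y => (φ y).1) :=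
  _root_.contMDiff_fst.comp hφ.smooth

theorem IsImmersedHypersurface.contMDiff_snd (hφ : IsImmersedHypersurface n I φ) :
    ContMDiff 𝓘(ℝ, Model n) 𝓘(ℝ, Model n) ∞ (fun y => (φ y).2) :=
  _root_.contMDiff_snd.comp hφ.smooth

theorem IsImmersedHypersurface.mdifferentiableAt_fst (hφ : IsImmersedHypersurface n I φ) (y : M) :
    MDifferentiableAt 𝓘(ℝ, Model n) 𝓘(ℝ, ℝ) (fun y => (φ y).1) y :=
  hφ.contMDiff_fst.contMDiffAt.mdifferentiableAt (by simp)

theorem IsImmersedHypersurface.mdifferentiableAt_snd (hφ : IsImmersedHypersurface n I φ) (y : M) :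
    MDifferentiableAt 𝓘(ℝ, Model n) 𝓘(ℝ, Model n) (fun y => (φ y).2) y :=
  hφ.contMDiff_snd.contMDiffAt.mdifferentiableAt (by simp)

/-- The differential of the time component of `φ`. -/
noncomputable abbrev dTime (φ : M → ℝ × P) (y : M) (v : TangentSpace 𝓘(ℝ, Model n) y) : ℝ :=
  mfderiv 𝓘(ℝ, Model n) 𝓘(ℝ, ℝ) (fun y => (φ y).1) y v

/-- The differential of the space component of `φ`. -/
noncomputable abbrev dSpace (φ : M → ℝ × P) (y : M) (v : TangentSpace 𝓘(ℝ, Model n) y) :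
    TangentSpace 𝓘(ℝ, Model n) (φ y).2 :=
  mfderiv 𝓘(ℝ, Model n) 𝓘(ℝ, Model n) (fun y => (φ y).2) y v

theorem IsImmersedHypersurface.mfderiv_apply (hφ : IsImmersedHypersurface n I φ) (y : M)
    (v : TangentSpace 𝓘(ℝ, Model n) y) :
    mfderiv 𝓘(ℝ, Model n) (𝓘(ℝ, ℝ).prod 𝓘(ℝ, Model n)) φ y v =
      (show ℝ × Model n from (dTime φ y v, dSpace φ y v)) := by
  have h := (hφ.mdifferentiableAt_fst y).mfderiv_prod (hφ.mdifferentiableAt_snd y)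
  exact congrArg (fun T : Model n →L[ℝ] ℝ × Model n => T v) h

theorem IsImmersedHypersurface.timePart_mfderiv (hφ : IsImmersedHypersurface n I φ) (y : M)
    (v : TangentSpace 𝓘(ℝ, Model n) y) :
    timePart (mfderiv 𝓘(ℝ, Model n) (𝓘(ℝ, ℝ).prod 𝓘(ℝ, Model n)) φ y v) = dTime φ y v := by
  rw [hφ.mfderiv_apply]; rfl

theorem IsImmersedHypersurface.spacePart_mfderiv (hφ : IsImmersedHypersurface n I φ) (y : M)
    (v : TangentSpace 𝓘(ℝ, Model n) y) :
    spacePart (mfderiv 𝓘(ℝ, Model n) (𝓘(ℝ, ℝ).prod 𝓘(ℝ, Model n)) φ y v) = dSpace φ y v := by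
  rw [hφ.mfderiv_apply]; rfl

theorem IsImmersedHypersurface.eq_zero (hφ : IsImmersedHypersurface n I φ) {y : M}
    {v : TangentSpace 𝓘(ℝ, Model n) y} (h1 : dTime φ y v = 0) (h2 : dSpace φ y v = 0) :
    v = 0 := by
  apply hφ.injective_mfderiv y
  rw [map_zero, hφ.mfderiv_apply, h1, h2]
  rfl

/-- The tangent hyperplane of a hypersurface is the kernel of any nonzero covector vanishing on
it. -/
theorem IsImmersedHypersurface.exists_tangent (hφ : IsImmersedHypersurface n I φ) {y : M}
    {α : ℝ} {β : TangentSpace 𝓘(ℝ, Model n) (φ y).2 →ₗ[ℝ] ℝ} (h0 : α ≠ 0 ∨ β ≠ 0)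
    (h : ∀ v, α * dTime φ y v + β (dSpace φ y v) = 0) {a : ℝ}
    {w : TangentSpace 𝓘(ℝ, Model n) (φ y).2} (hw : α * a + β w = 0) :
    ∃ v, dTime φ y v = a ∧ dSpace φ y v = w := by
  let A : Model n →L[ℝ] ℝ × Model n :=
    mfderiv 𝓘(ℝ, Model n) (𝓘(ℝ, ℝ).prod 𝓘(ℝ, Model n)) φ y
  have hA : ∀ v, A v = (dTime φ y v, dSpace φ y v) := hφ.mfderiv_apply y
  let β' : Model n →ₗ[ℝ] ℝ := β
  let l : ℝ × Model n →ₗ[ℝ] ℝ := (α • LinearMap.id).coprod β'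
  have hl : ∀ z, l z = α * z.1 + β z.2 := fun z => rfl
  have hl0 : l ≠ 0 := by
    intro hl0
    rcases h0 with h0 | h0
    · apply h0
      have := hl (1, 0)
      rw [hl0] at this
      simpa [show β (0 : Model n) = 0 from map_zero β] using this.symm
    · apply h0
      ext v
      have := hl (0, v)
      rw [hl0] at this
      simpa using this.symm
  obtain ⟨v, hv⟩ := LinearMap.exists_apply_eq_of_finrank_eq_succ (A := (A : Model n →ₗ[ℝ] _))
    (by simp [add_comm]) (hφ.injective_mfderiv y) hl0
    (fun v => (congrArg l (hA v)).trans (h v))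
    (w := ((a, w) : ℝ × Model n)) hw
  have hv' := (hA v).symm.trans hv
  exact ⟨v, congrArg Prod.fst hv', congrArg Prod.snd hv'⟩

end Immersion

/-! ### The time component of the unit normal. -/

section Normal

variable {n : ℕ} {P : Type*} [TopologicalSpace P] [ChartedSpace (Model n) P]
  [RiemannianBundle (fun p : P ↦ TangentSpace 𝓘(ℝ, Model n) p)]
  {ρ : ℝ → ℝ}

theorem warpedNorm_partialT (x : ℝ × P) : warpedNorm ρ x (partialT (n := n) x) = 1 := by
  have h1 : timePart (partialT (n := n) x) = 1 := rfl
  have h2 : spacePart (partialT (n := n) x) = 0 := rfl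
  rw [warpedNorm, warpedInner, h1, h2, inner_zero_left]
  simp

theorem warpedInner_partialT (x : ℝ × P) (w : TangentAmbient n x) :
    warpedInner ρ x (partialT x) w = timePart w := by
  have h1 : timePart (partialT (n := n) x) = 1 := rfl
  have h2 : spacePart (partialT (n := n) x) = 0 := rfl
  rw [warpedInner, h1, h2, inner_zero_left]
  simp

variable [IsManifold 𝓘(ℝ, Model n) ∞ P] {M : Type*} [TopologicalSpace M]
  [ChartedSpace (Model n) M] {I : Set ℝ} {φ : M → ℝ × P} {ξ : ∀ x : M, TangentAmbient n (φ x)}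

theorem IsUnitNormalField.time_space (hξ : IsUnitNormalField ρ φ ξ) (y : M) :
    timePart (ξ y) ^ 2 + ρ (φ y).1 ^ 2 * ‖spacePart (ξ y)‖ ^ 2 = 1 := by
  have h := hξ.unit y
  rw [warpedNorm, Real.sqrt_eq_one, warpedInner, real_inner_self_eq_norm_sq] at h
  rw [← h]; ring

theorem IsUnitNormalField.warpedAngle_partialT (hξ : IsUnitNormalField ρ φ ξ) (y : M) :
    warpedAngle ρ (φ y) (partialT (φ y)) (ξ y) = Real.arccos (timePart (ξ y)) := by
  rw [warpedAngle, warpedInner_partialT, warpedNorm_partialT, hξ.unit]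
  simp

theorem IsUnitNormalField.abs_timePart_le (hξ : IsUnitNormalField ρ φ ξ) (y : M) :
    |timePart (ξ y)| ≤ 1 := by
  rw [← sq_le_one_iff_abs_le_one]
  nlinarith [hξ.time_space y, mul_nonneg (sq_nonneg (ρ (φ y).1)) (sq_nonneg ‖spacePart (ξ y)‖)]

theorem IsUnitNormalField.warpedAngle_eq_iff (hξ : IsUnitNormalField ρ φ ξ) (y : M) {θ : ℝ}
    (h0 : 0 ≤ θ) (hπ : θ ≤ Real.pi) :
    warpedAngle ρ (φ y) (partialT (φ y)) (ξ y) = θ ↔ timePart (ξ y) = Real.cos θ := by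
  rw [hξ.warpedAngle_partialT]
  have := abs_le.1 (hξ.abs_timePart_le y)
  constructor
  · rintro rfl
    exact (Real.cos_arccos this.1 this.2).symm
  · intro h
    rw [h, Real.arccos_cos h0 hπ]

theorem IsUnitNormalField.normal_eq (hφ : IsImmersedHypersurface n I φ)
    (hξ : IsUnitNormalField ρ φ ξ) (y : M) (v : TangentSpace 𝓘(ℝ, Model n) y) :
    timePart (ξ y) * dTime φ y v +
      ρ (φ y).1 ^ 2 * inner ℝ (spacePart (ξ y)) (dSpace φ y v) = 0 := by
  have h := hξ.normal y v
  rw [warpedInner, hφ.timePart_mfderiv, hφ.spacePart_mfderiv, real_inner_comm] at h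
  linarith

theorem IsUnitNormalField.exists_tangent (hφ : IsImmersedHypersurface n I φ)
    (hξ : IsUnitNormalField ρ φ ξ) {y : M} {a : ℝ} {w : TangentSpace 𝓘(ℝ, Model n) (φ y).2}
    (hw : timePart (ξ y) * a + ρ (φ y).1 ^ 2 * inner ℝ (spacePart (ξ y)) w = 0) :
    ∃ v, dTime φ y v = a ∧ dSpace φ y v = w := by
  refine hφ.exists_tangent (α := timePart (ξ y))
    (β := ρ (φ y).1 ^ 2 • (innerSL ℝ (spacePart (ξ y))).toLinearMap) ?_
    (hξ.normal_eq hφ y) hw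
  -- If the covector vanished, evaluating it at the space part of `ξ` would give `ρ² |ζ|² = 0`
  -- together with `τ = 0`, against unit length.
  by_contra! h
  have h1 := hξ.time_space y
  have h2 := LinearMap.congr_fun h.2 (spacePart (ξ y))
  simp only [LinearMap.smul_apply, ContinuousLinearMap.coe_coe, innerSL_apply_apply, smul_eq_mul,
    real_inner_self_eq_norm_sq, LinearMap.zero_apply] at h2
  rw [h.1, h2] at h1
  norm_num at h1

/-- Over a graph `t = f(p)` the unit normal is `± (1, -∇f / ρ²) / √(1 + |∇f|² / ρ²)`. -/
theorem IsUnitNormalField.timePart_sq_of_graph (hφ : IsImmersedHypersurface n I φ)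
    (hξ : IsUnitNormalField ρ φ ξ) {y : M} {f : P → ℝ}
    (hf : MDifferentiableAt 𝓘(ℝ, Model n) 𝓘(ℝ, ℝ) f (φ y).2)
    (hfφ : (fun z => (φ z).1) =ᶠ[nhds y] fun z => f (φ z).2) :
    timePart (ξ y) ^ 2 * (ρ (φ y).1 ^ 2 + ‖grad n f (φ y).2‖ ^ 2) = ρ (φ y).1 ^ 2 := by
  have hd : ∀ v, dTime φ y v = inner ℝ (grad n f (φ y).2) (dSpace φ y v) := by
    intro v
    have h1 := mfderiv_comp (I := 𝓘(ℝ, Model n)) y (g := f) hf (hφ.mdifferentiableAt_snd y)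
    have h2 := hfφ.mfderiv_eq (I := 𝓘(ℝ, Model n)) (I' := 𝓘(ℝ, ℝ))
    rw [inner_grad]
    exact congrArg (fun T : Model n →L[ℝ] ℝ => T v) (h2.trans h1)
  -- The covector `-dt + df` vanishes on the tangent hyperplane, so each `(⟨∇f, w⟩, w)` is tangent;
  -- normality to these vectors gives `ρ² ζ = -τ ∇f`.
  have hs : ρ (φ y).1 ^ 2 • spacePart (ξ y) = -(timePart (ξ y) • grad n f (φ y).2) := by
    apply ext_inner_right ℝ
    intro w
    obtain ⟨v, hv1, hv2⟩ := hφ.exists_tangent (y := y) (α := -1)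
      (β := (innerSL ℝ (grad n f (φ y).2)).toLinearMap) (Or.inl (by norm_num))
      (fun v => by rw [hd v]; simp) (a := inner ℝ (grad n f (φ y).2) w) (w := w) (by simp)
    have := hξ.normal_eq hφ y v
    rw [hv1, hv2] at this
    rw [inner_neg_left, real_inner_smul_left, real_inner_smul_left]
    linarith
  have hn : ρ (φ y).1 ^ 4 * ‖spacePart (ξ y)‖ ^ 2 =
      timePart (ξ y) ^ 2 * ‖grad n f (φ y).2‖ ^ 2 := by
    have := congrArg (fun u => ‖u‖ ^ 2) hs
    simp only [norm_neg, norm_smul, mul_pow, Real.norm_eq_abs, sq_abs] at this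
    rw [← this]; ring
  have ht := hξ.time_space y
  have : ρ (φ y).1 ^ 2 * (timePart (ξ y) ^ 2 + ρ (φ y).1 ^ 2 * ‖spacePart (ξ y)‖ ^ 2) =
    ρ (φ y).1 ^ 2 := by rw [ht, mul_one]
  linarith

/-- The time component is the fibre coordinate of the image of `ξ` under the tangent map of the
projection to `ℝ`. -/
theorem IsUnitNormalField.continuous_timePart (hξ : IsUnitNormalField ρ φ ξ) :
    Continuous fun y => timePart (ξ y) := by
  have h1 : ContMDiff (𝓘(ℝ, ℝ).prod 𝓘(ℝ, Model n)) 𝓘(ℝ, ℝ) ∞ (Prod.fst : ℝ × P → ℝ) :=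
    contMDiff_fst
  have h2 := (h1.contMDiff_tangentMap (m := 0) (by simp)).comp (hξ.smooth.of_le (by simp))
  have h3 := (contMDiff_snd_tangentBundle_modelSpace (n := 0) ℝ 𝓘(ℝ, ℝ)).comp h2
  refine h3.continuous.congr fun y => ?_
  exact congrArg (fun T : ℝ × Model n →L[ℝ] ℝ => T (ξ y))
    (mfderiv_fst (I := 𝓘(ℝ, ℝ)) (I' := 𝓘(ℝ, Model n)) (x := φ y))

theorem IsUnitNormalField.neg (hξ : IsUnitNormalField ρ φ ξ) :
    IsUnitNormalField ρ φ (fun y => -ξ y) := by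
  have ht : ∀ y, timePart (-ξ y) = -timePart (ξ y) := fun y => rfl
  have hs : ∀ y, spacePart (-ξ y) = -spacePart (ξ y) := fun y => rfl
  refine ⟨fun x => ?_, fun x v => ?_, fun x => ?_⟩
  · have h := hξ.smooth x
    rw [contMDiffAt_totalSpace] at h ⊢
    refine ⟨h.1, ?_⟩
    refine h.2.neg.congr_of_eventuallyEq ?_
    -- Smoothness is read in a trivialization, which is linear on fibres and so commutes with
    -- negation.
    let e := trivializationAt (ℝ × Model n)
      (TangentSpace (𝓘(ℝ, ℝ).prod 𝓘(ℝ, Model n)) : ℝ × P → Type _) (φ x)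
    have hc : ContinuousAt φ x := h.1.continuousAt
    filter_upwards [hc.preimage_mem_nhds (e.open_baseSet.mem_nhds
      (FiberBundle.mem_baseSet_trivializationAt' (φ x)))] with y hy
    exact (e.linear ℝ hy).map_neg (ξ y)
  · have := hξ.normal x v
    simp only [warpedInner, ht, hs, inner_neg_right] at this ⊢
    linarith
  · have := hξ.unit x
    simpa only [warpedNorm, warpedInner, ht, hs, inner_neg_right, inner_neg_left, neg_neg,
      neg_mul_neg] using this

end Normal

/-! ### Angles below `π / 2` and eikonal graphs. -/

section Graph

variable {n : ℕ} {P : Type*} [TopologicalSpace P] [ChartedSpace (Model n) P]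
  [RiemannianBundle (fun p : P ↦ TangentSpace 𝓘(ℝ, Model n) p)]
  [IsManifold 𝓘(ℝ, Model n) ∞ P] {M : Type*} [TopologicalSpace M]
  [ChartedSpace (Model n) M] {I : Set ℝ} {ρ : ℝ → ℝ} {φ : M → ℝ × P}
  {ξ : ∀ x : M, TangentAmbient n (φ x)}

theorem IsUnitNormalField.isLocallyTransnormalGraph [IsManifold 𝓘(ℝ, Model n) ∞ M]
    (hφ : IsImmersedHypersurface n I φ) (hρ : ∀ t ∈ I, 0 < ρ t) (hξ : IsUnitNormalField ρ φ ξ)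
    {θ : ℝ} (h0 : 0 ≤ θ) (hθ : θ < Real.pi / 2) (hξθ : ∀ y, timePart (ξ y) = Real.cos θ) :
    IsLocallyTransnormalGraph n I ρ (Real.tan θ) φ := by
  intro x
  have hcos : 0 < Real.cos θ := Real.cos_pos_of_mem_Ioo ⟨by linarith, hθ⟩
  -- A tangent vector with zero space part satisfies `cos θ · dTime v = 0` by normality, hence
  -- vanishes; so the projection to `P` is locally invertible, with inverse `e.symm`.
  have hinj : Function.Injective
      (mfderiv 𝓘(ℝ, Model n) 𝓘(ℝ, Model n) (fun y => (φ y).2) x) := by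
    rw [injective_iff_map_eq_zero]
    intro v (hv : dSpace φ x v = 0)
    have h := hξ.normal_eq hφ x v
    rw [hv, inner_zero_right, mul_zero, add_zero, hξθ] at h
    exact hφ.eq_zero ((mul_eq_zero.1 h).resolve_left hcos.ne') hv
  obtain ⟨e, hxe, -, he, hesymm⟩ := hφ.contMDiff_snd.contMDiffOn.exists_openPartialHomeomorph
    isOpen_univ (mem_univ x) hinj
  have hfφ : ∀ y ∈ e.source, (φ y).1 = (φ (e.symm (φ y).2)).1 := by
    intro y hy
    rw [← show e y = (φ y).2 from he hy, e.left_inv hy]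
  have hsymm : ∀ p ∈ e.target, (φ (e.symm p)).2 = p := fun p hp =>
    (he (e.map_target hp)).symm.trans (e.right_inv hp)
  have hsm : ContMDiffOn 𝓘(ℝ, Model n) 𝓘(ℝ, ℝ) ∞ (fun p => (φ (e.symm p)).1) e.target :=
    hφ.contMDiff_fst.comp_contMDiffOn hesymm
  refine ⟨e.source, e.target, fun p => (φ (e.symm p)).1, e.open_source, hxe, ?_, e.open_target,
    ⟨hsm, fun p _ => hφ.mem _, ?_⟩, ?_⟩
  · intro y hy z hz hyz
    apply e.injOn hy hz
    rw [he hy, he hz]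
    exact congrArg Prod.snd hyz
  · intro p hp
    have hy := e.map_target hp
    have hmd : MDifferentiableAt 𝓘(ℝ, Model n) 𝓘(ℝ, ℝ) (fun p => (φ (e.symm p)).1)
        (φ (e.symm p)).2 := by
      rw [hsymm p hp]
      exact (hsm.contMDiffAt (e.open_target.mem_nhds hp)).mdifferentiableAt (by simp)
    have key := hξ.timePart_sq_of_graph hφ hmd
      (Filter.eventually_of_mem (e.open_source.mem_nhds hy) hfφ)
    rw [hξθ, hsymm p hp] at key
    have hρp := hρ _ (hφ.mem (e.symm p))
    have htan : 0 ≤ Real.tan θ := Real.tan_nonneg_of_nonneg_of_le_pi_div_two h0 hθ.le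
    rw [← sq_eq_sq₀ (norm_nonneg _) (mul_nonneg htan hρp.le), mul_pow, Real.tan_eq_sin_div_cos,
      div_pow, Real.sin_sq]
    field_simp
    linarith
  · ext ⟨t, p⟩
    constructor
    · rintro ⟨y, hy, hyt⟩
      refine ⟨(φ y).2, (congrArg (· ∈ e.target) (he hy)).mp (e.map_source hy), ?_⟩
      rw [← hyt]
      exact Prod.ext (hfφ y hy).symm rfl
    · rintro ⟨q, hq, hqt⟩
      refine ⟨e.symm q, e.map_target hq, ?_⟩
      rw [← hqt]
      exact Prod.ext rfl (hsymm q hq)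

/-- Substituting `|∇f| = C ρ` in the graph formula and cancelling `ρ²` gives the identity; `C ≥ 0`
because a norm is nonnegative and `ρ > 0`. -/
theorem IsUnitNormalField.timePart_sq_of_isLocallyTransnormalGraph
    (hφ : IsImmersedHypersurface n I φ) (hρ : ∀ t ∈ I, 0 < ρ t) (hξ : IsUnitNormalField ρ φ ξ)
    {C : ℝ} (hC : IsLocallyTransnormalGraph n I ρ C φ) (y : M) :
    0 ≤ C ∧ timePart (ξ y) ^ 2 * (1 + C ^ 2) = 1 := by
  obtain ⟨U, Ω, f, hU, hyU, -, hΩ, hf, him⟩ := hC y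
  have hmem : ∀ z ∈ U, (φ z).2 ∈ Ω ∧ (φ z).1 = f (φ z).2 := by
    intro z hz
    obtain ⟨p, hp, hpz⟩ := him.subset (mem_image_of_mem φ hz)
    rw [← hpz]
    exact ⟨hp, rfl⟩
  obtain ⟨hyΩ, hyf⟩ := hmem y hyU
  have hρy := hρ _ (hφ.mem y)
  have hgrad := hf.eikonal _ hyΩ
  rw [← hyf] at hgrad
  have hC0 : 0 ≤ C := nonneg_of_mul_nonneg_left (hgrad ▸ norm_nonneg _) hρy
  have key := hξ.timePart_sq_of_graph hφ
    ((hf.smooth.contMDiffAt (hΩ.mem_nhds hyΩ)).mdifferentiableAt (by simp))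
    (Filter.eventually_of_mem (hU.mem_nhds hyU) fun z hz => (hmem z hz).2)
  rw [hgrad] at key
  refine ⟨hC0, mul_left_cancel₀ (pow_ne_zero 2 hρy.ne') ?_⟩
  linarith

/-- A locally transnormal graph has constant angle `arctan C`: the sign of the normal can be chosen
globally since the hypersurface is connected. -/
theorem IsUnitNormalField.hasConstantAngle_of_isLocallyTransnormalGraph [ConnectedSpace M]
    (hφ : IsImmersedHypersurface n I φ) (hρ : ∀ t ∈ I, 0 < ρ t) (hξ : IsUnitNormalField ρ φ ξ)
    {θ : ℝ} (h0 : 0 ≤ θ) (hθ : θ < Real.pi / 2)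
    (hC : IsLocallyTransnormalGraph n I ρ (Real.tan θ) φ) :
    HasConstantAngle n ρ φ θ := by
  have hcos : 0 < Real.cos θ := Real.cos_pos_of_mem_Ioo ⟨by linarith, hθ⟩
  have hsq : ∀ y, timePart (ξ y) ^ 2 = Real.cos θ ^ 2 := by
    intro y
    have h := (hξ.timePart_sq_of_isLocallyTransnormalGraph hφ hρ hC y).2
    rw [← Real.inv_one_add_tan_sq hcos.ne']
    exact eq_inv_of_mul_eq_one_left h
  have hπ : θ ≤ Real.pi := by linarith [Real.pi_pos]
  -- A continuous function with nonzero constant square is constant on connected `M`; a negative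
  -- sign is absorbed by replacing `ξ` with `-ξ`.
  rcases isPreconnected_univ.eq_or_eq_neg_of_sq_eq (f := fun y => timePart (ξ y))
    (g := fun _ => Real.cos θ) hξ.continuous_timePart.continuousOn continuousOn_const
    (fun y _ => hsq y) (fun _ => hcos.ne') with h | h
  · exact ⟨ξ, hξ, fun y => (hξ.warpedAngle_eq_iff y h0 hπ).2 (h (mem_univ y))⟩
  · refine ⟨_, hξ.neg, fun y => (hξ.neg.warpedAngle_eq_iff y h0 hπ).2 ?_⟩
    have h1 : timePart (-ξ y) = -timePart (ξ y) := rfl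
    have h2 : timePart (ξ y) = -Real.cos θ := h (mem_univ y)
    rw [h1, h2, neg_neg]

end Graph

/-! ### Cylinders have horizontal normals. -/

section Cylinder

variable {n : ℕ} {P : Type*} [TopologicalSpace P] [ChartedSpace (Model n) P]
  [RiemannianBundle (fun p : P ↦ TangentSpace 𝓘(ℝ, Model n) p)]
  [IsManifold 𝓘(ℝ, Model n) ∞ P] {M : Type*} [TopologicalSpace M]
  [ChartedSpace (Model n) M] {I : Set ℝ} {ρ : ℝ → ℝ} {φ : M → ℝ × P}
  {ξ : ∀ x : M, TangentAmbient n (φ x)}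

theorem IsUnitNormalField.timePart_eq_zero_of_isLocallyCylinder
    (hφ : IsImmersedHypersurface n I φ) (hξ : IsUnitNormalField ρ φ ξ)
    (hcyl : IsLocallyCylinder n I φ) (y : M) : timePart (ξ y) = 0 := by
  obtain ⟨U, L, W, hU, hyU, -, hL, -, him⟩ := hcyl y
  have hmem : ∀ z ∈ U, (φ z).2 ∈ L := fun z hz => (him.subset (mem_image_of_mem φ hz)).2.2
  obtain ⟨V, g, hV, hyV, hg, hdg, hLV⟩ := hL _ (hmem y hyU)
  have hgφ : (fun z => g (φ z).2) =ᶠ[nhds y] fun _ => (0 : ℝ) := by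
    filter_upwards [hU.mem_nhds hyU,
      (hV.preimage hφ.contMDiff_snd.continuous).mem_nhds hyV] with z hz hzV
    exact (hLV.subset ⟨hmem z hz, hzV⟩).2
  have hgd : MDifferentiableAt 𝓘(ℝ, Model n) 𝓘(ℝ, ℝ) g (φ y).2 :=
    (hg.contMDiffAt (hV.mem_nhds hyV)).mdifferentiableAt (by simp)
  let β : TangentSpace 𝓘(ℝ, Model n) (φ y).2 →L[ℝ] ℝ := mfderiv 𝓘(ℝ, Model n) 𝓘(ℝ, ℝ) g (φ y).2
  have hβ : ∀ v, β (dSpace φ y v) = 0 := by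
    intro v
    have h1 := mfderiv_comp (I := 𝓘(ℝ, Model n)) y (g := g) hgd (hφ.mdifferentiableAt_snd y)
    have h2 := hgφ.mfderiv_eq (I := 𝓘(ℝ, Model n)) (I' := 𝓘(ℝ, ℝ))
    have h3 := mfderiv_const (I := 𝓘(ℝ, Model n)) (I' := 𝓘(ℝ, ℝ)) (x := y) (c := (0 : ℝ))
    exact congrArg (fun T : Model n →L[ℝ] ℝ => T v) (h1.symm.trans (h2.trans h3))
  -- The nonzero covector `(0, dg)` vanishes on the tangent hyperplane, so `(1, 0)` is tangent;
  -- pairing it with `ξ` gives `τ = 0`.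
  obtain ⟨v, hv1, hv2⟩ := hφ.exists_tangent (y := y) (α := 0) (β := β.toLinearMap) (a := 1) (w := 0)
    (Or.inr fun h => hdg _ hyV (ContinuousLinearMap.coe_injective h))
    (fun v => by rw [zero_mul, zero_add]; exact hβ v) (by simp)
  have h := hξ.normal_eq hφ y v
  rwa [hv1, hv2, inner_zero_right, mul_zero, add_zero, mul_one] at h

end Cylinder

/-! ### Splitting a chart as `ker l ⊕ ℝ ν`, and graphs over `ker l`. -/

section Cylinder

/-- The projection of `E` to `ker l` along `ν`, for `l ν = 1`. -/
noncomputable def projKer {E : Type*} [NormedAddCommGroup E] [NormedSpace ℝ E]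
    (l : E →L[ℝ] ℝ) (ν : E) : E →L[ℝ] E :=
  ContinuousLinearMap.id ℝ E - l.smulRight ν

section

variable {E : Type*} [NormedAddCommGroup E] [NormedSpace ℝ E] {l : E →L[ℝ] ℝ} {ν : E}

theorem projKer_apply (y : E) : projKer l ν y = y - l y • ν := rfl

theorem projKer_add (y : E) : projKer l ν y + l y • ν = y := by
  rw [projKer_apply, sub_add_cancel]

theorem apply_projKer (hν : l ν = 1) (y : E) : l (projKer l ν y) = 0 := by
  simp [projKer_apply, hν]

theorem projKer_self (hν : l ν = 1) : projKer l ν ν = 0 := by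
  simp [projKer_apply, hν]

theorem projKer_projKer_add (hν : l ν = 1) (y : E) (t : ℝ) :
    projKer l ν (projKer l ν y + t • ν) = projKer l ν y := by
  rw [projKer_apply, map_add, apply_projKer hν, map_smul, hν]
  simp

theorem apply_projKer_add (hν : l ν = 1) (y : E) (t : ℝ) :
    l (projKer l ν y + t • ν) = t := by
  simp [apply_projKer hν, hν]

/-- The points whose components in `ker l` and along `ν` are closer than `ε` to those of `z`. -/
def box (l : E →L[ℝ] ℝ) (ν z : E) (ε : ℝ) : Set E :=
  {y | |l y - l z| < ε ∧ ‖projKer l ν y - projKer l ν z‖ < ε}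

theorem isOpen_box (z : E) (ε : ℝ) : IsOpen (box l ν z ε) := by
  have h1 : Continuous fun y => |l y - l z| := by fun_prop
  have h2 : Continuous fun y => ‖projKer l ν y - projKer l ν z‖ := by fun_prop
  exact (isOpen_lt h1 continuous_const).inter (isOpen_lt h2 continuous_const)

theorem self_mem_box (z : E) {ε : ℝ} (hε : 0 < ε) : z ∈ box l ν z ε := by
  simp [box, hε]

theorem exists_box_subset {O : Set E} (hO : IsOpen O) {z : E} (hz : z ∈ O) :
    ∃ ε > 0, box l ν z ε ⊆ O := by
  obtain ⟨δ, hδ, hδO⟩ := Metric.isOpen_iff.1 hO z hz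
  have hν : 0 < 1 + ‖ν‖ := by positivity
  -- On a box of size `ε` the splitting gives `‖y - z‖ < ε (1 + ‖ν‖)`.
  refine ⟨δ / (1 + ‖ν‖), by positivity, fun y hy => hδO ?_⟩
  rw [mem_ball_iff_norm]
  have h : y - z = (projKer l ν y - projKer l ν z) + (l y - l z) • ν := by
    simp only [projKer_apply, sub_smul]; abel
  calc ‖y - z‖ ≤ ‖projKer l ν y - projKer l ν z‖ + ‖(l y - l z) • ν‖ := h ▸ norm_add_le _ _
    _ = ‖projKer l ν y - projKer l ν z‖ + |l y - l z| * ‖ν‖ := by rw [norm_smul, Real.norm_eq_abs]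
    _ < δ / (1 + ‖ν‖) + δ / (1 + ‖ν‖) * ‖ν‖ :=
      add_lt_add_of_lt_of_le hy.2 (mul_le_mul_of_nonneg_right hy.1.le (norm_nonneg _))
    _ = δ := by field_simp

theorem projKer_add_mem_box (hν : l ν = 1) {z y : E} {ε t : ℝ} (ht : |t - l z| < ε)
    (hy : ‖projKer l ν y - projKer l ν z‖ < ε) : projKer l ν y + t • ν ∈ box l ν z ε := by
  rw [box, mem_ofPred_eq, apply_projKer_add hν, projKer_projKer_add hν]
  exact ⟨ht, hy⟩

/-- A function with vanishing derivative along `ν` depends only on the component in `ker l`. -/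
theorem eq_of_fderiv_apply_eq_zero (hν : l ν = 1) {h : E → ℝ} {z : E} {ε : ℝ} (hε : 0 < ε)
    (hd : ∀ y ∈ box l ν z ε, DifferentiableAt ℝ h y)
    (h0 : ∀ y ∈ box l ν z ε, fderiv ℝ h y ν = 0) {y : E} (hy : y ∈ box l ν z ε) :
    h y = h (projKer l ν y + l z • ν) := by
  have hder : ∀ t ∈ Metric.ball (l z) ε,
      HasDerivAt (fun t : ℝ => h (projKer l ν y + t • ν)) 0 t := by
    intro t ht
    have hm : projKer l ν y + t • ν ∈ box l ν z ε := projKer_add_mem_box hν ht hy.2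
    have h1 : HasDerivAt (fun t : ℝ => projKer l ν y + t • ν) ν t := by
      simpa using ((hasDerivAt_id t).smul_const ν).const_add (projKer l ν y)
    have h2 := (hd _ hm).hasFDerivAt.comp_hasDerivAt t h1
    rwa [h0 _ hm] at h2
  have h := Metric.isOpen_ball.is_const_of_deriv_eq_zero
    (convex_ball (l z) ε).isPreconnected
    (fun t ht => (hder t ht).differentiableAt.differentiableWithinAt)
    (fun t ht => (hder t ht).deriv) (x := l y) (y := l z) hy.1 (Metric.mem_ball_self hε)
  simpa only [projKer_add] using h

end

variable {n : ℕ} {P : Type*} [TopologicalSpace P] [ChartedSpace (Model n) P]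

/-- The graph of a smooth function over a hyperplane in a chart is a hypersurface. -/
theorem isHypersurface_graph [IsManifold 𝓘(ℝ, Model n) ∞ P] (p : P) {l : Model n →L[ℝ] ℝ}
    {ν : Model n} (hν : l ν = 1) {h : Model n → ℝ} {z : Model n} {ε : ℝ} (hε : 0 < ε)
    (hh : ContDiffOn ℝ ∞ h (box l ν z ε)) :
    IsHypersurface n {q : P | (q ∈ (chartAt (Model n) p).source ∧
      ‖projKer l ν (chartAt (Model n) p q) - projKer l ν z‖ < ε) ∧
      l (chartAt (Model n) p q) = h (projKer l ν (chartAt (Model n) p q) + l z • ν)} := by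
  let c := chartAt (Model n) p
  let D : Set (Model n) := {y | ‖projKer l ν y - projKer l ν z‖ < ε}
  have hD : IsOpen D := isOpen_lt (by fun_prop) continuous_const
  let G : Model n → ℝ := fun y => l y - h (projKer l ν y + l z • ν)
  have hm : ∀ y ∈ D, projKer l ν y + l z • ν ∈ box l ν z ε := fun y hy =>
    projKer_add_mem_box hν (by simpa using hε) hy
  have hG : ContDiffOn ℝ ∞ G D :=
    l.contDiff.contDiffOn.sub (hh.comp (by fun_prop) hm)
  -- The term with `h` factors through `projKer l ν`, which kills `ν`; only `l ν = 1` remains, so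
  -- `G` has no critical points.
  have hGν : ∀ y ∈ D, fderiv ℝ G y ν = 1 := by
    intro y hy
    have h1 : DifferentiableAt ℝ h (projKer l ν y + l z • ν) :=
      (hh.contDiffAt ((isOpen_box z ε).mem_nhds (hm y hy))).differentiableAt (by simp)
    have h2 : HasFDerivAt (fun y => projKer l ν y + l z • ν) (projKer l ν) y :=
      (projKer l ν).hasFDerivAt.add_const _
    have h3 := (l.hasFDerivAt (x := y)).sub (h1.hasFDerivAt.comp y h2)
    have h4 : HasFDerivAt G _ y := h3
    rw [h4.fderiv]
    simp [projKer_self hν, hν]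
  have hV : IsOpen (c.source ∩ c ⁻¹' D) := c.isOpen_inter_preimage hD
  intro q hq
  refine ⟨c.source ∩ c ⁻¹' D, G ∘ c, hV, hq.1, ?_, ?_, ?_⟩
  · exact (contMDiffOn_iff_contDiffOn.2 hG).comp
      ((contMDiffOn_chart (x := p)).mono inter_subset_left) fun r hr => hr.2
  · intro r hr h0
    have hGr : DifferentiableAt ℝ G (c r) :=
      (hG.contDiffAt (hD.mem_nhds hr.2)).differentiableAt (by simp)
    have hc := mdifferentiable_chart (I := 𝓘(ℝ, Model n)) p
    have h1 := mfderiv_comp (I := 𝓘(ℝ, Model n)) r hGr.mdifferentiableAt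
      (hc.mdifferentiableAt hr.1)
    obtain ⟨w, hw⟩ := hc.mfderiv_surjective hr.1 ν
    have h2 := congrArg (fun T : Model n →L[ℝ] ℝ => T w) (h1.symm.trans h0)
    have h3 : mfderiv 𝓘(ℝ, Model n) 𝓘(ℝ, ℝ) G (c r) = fderiv ℝ G (c r) := mfderiv_eq_fderiv
    have h4 : fderiv ℝ G (c r) ν = 0 := by
      rw [← h3, ← hw]
      exact h2
    rw [hGν _ hr.2] at h4
    exact one_ne_zero h4
  · ext r
    simp only [mem_inter_iff, mem_ofPred_eq, Function.comp_apply, G, sub_eq_zero, D, mem_preimage, c]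
    tauto

end Cylinder

/-! ### Hypersurfaces with vertical tangent vectors are cylinders. -/

section Vertical

variable {n : ℕ} {P : Type*} [TopologicalSpace P] [ChartedSpace (Model n) P]
  {M : Type*} {I : Set ℝ} {φ : M → ℝ × P}

/-- The map `M → E` whose component in `ker l` is that of `φ` in the chart at `p`, and whose
component along `ν` is the time component of `φ`. -/
noncomputable def heightMap (p : P) (l : Model n →L[ℝ] ℝ) (ν : Model n) (φ : M → ℝ × P) (y : M) :
    Model n :=
  projKer l ν (chartAt (Model n) p (φ y).2) + (φ y).1 • ν

theorem apply_heightMap (p : P) {l : Model n →L[ℝ] ℝ} {ν : Model n} (hν : l ν = 1) (y : M) :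
    l (heightMap p l ν φ y) = (φ y).1 :=
  apply_projKer_add hν _ _

theorem projKer_heightMap (p : P) {l : Model n →L[ℝ] ℝ} {ν : Model n} (hν : l ν = 1) (y : M) :
    projKer l ν (heightMap p l ν φ y) = projKer l ν (chartAt (Model n) p (φ y).2) :=
  projKer_projKer_add hν _ _

variable [IsManifold 𝓘(ℝ, Model n) ∞ P] [TopologicalSpace M] [ChartedSpace (Model n) M]

theorem IsImmersedHypersurface.contMDiffOn_chart (hφ : IsImmersedHypersurface n I φ) (p : P) :
    ContMDiffOn 𝓘(ℝ, Model n) 𝓘(ℝ, Model n) ∞ (fun y => chartAt (Model n) p (φ y).2)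
      ((fun y => (φ y).2) ⁻¹' (chartAt (Model n) p).source) :=
  (_root_.contMDiffOn_chart (x := p)).comp hφ.contMDiff_snd.contMDiffOn fun _ hy => hy

theorem IsImmersedHypersurface.hasMFDerivAt_chart (hφ : IsImmersedHypersurface n I φ) {p : P}
    {y : M} (hy : (φ y).2 ∈ (chartAt (Model n) p).source) :
    HasMFDerivAt 𝓘(ℝ, Model n) 𝓘(ℝ, Model n) (fun y => chartAt (Model n) p (φ y).2) y
      ((mfderiv 𝓘(ℝ, Model n) 𝓘(ℝ, Model n) (chartAt (Model n) p) (φ y).2).comp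
        (mfderiv 𝓘(ℝ, Model n) 𝓘(ℝ, Model n) (fun y => (φ y).2) y)) :=
  (((mdifferentiable_chart (I := 𝓘(ℝ, Model n)) p).mdifferentiableAt hy).hasMFDerivAt).comp y
    (hφ.mdifferentiableAt_snd y).hasMFDerivAt

theorem IsImmersedHypersurface.contMDiffOn_heightMap (hφ : IsImmersedHypersurface n I φ) (p : P)
    (l : Model n →L[ℝ] ℝ) (ν : Model n) :
    ContMDiffOn 𝓘(ℝ, Model n) 𝓘(ℝ, Model n) ∞ (heightMap p l ν φ)
      ((fun y => (φ y).2) ⁻¹' (chartAt (Model n) p).source) := by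
  have h1 := (projKer l ν).contDiff.contMDiff.comp_contMDiffOn (n := ∞) (hφ.contMDiffOn_chart p)
  have h2 := ((ContinuousLinearMap.id ℝ ℝ).smulRight ν).contDiff.contMDiff.comp (n := ∞)
    hφ.contMDiff_fst
  exact h1.add h2.contMDiffOn

theorem IsImmersedHypersurface.mfderiv_heightMap (hφ : IsImmersedHypersurface n I φ) {p : P}
    (l : Model n →L[ℝ] ℝ) (ν : Model n) {y : M} (hy : (φ y).2 ∈ (chartAt (Model n) p).source)
    (v : TangentSpace 𝓘(ℝ, Model n) y) :
    mfderiv 𝓘(ℝ, Model n) 𝓘(ℝ, Model n) (heightMap p l ν φ) y v =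
      projKer l ν (mfderiv 𝓘(ℝ, Model n) 𝓘(ℝ, Model n) (chartAt (Model n) p) (φ y).2
        (dSpace φ y v)) + dTime φ y v • ν := by
  have h1 := (projKer l ν).hasMFDerivAt.comp y (hφ.hasMFDerivAt_chart hy)
  have h2 := ((ContinuousLinearMap.id ℝ ℝ).smulRight ν).hasMFDerivAt.comp y
    (hφ.mdifferentiableAt_fst y).hasMFDerivAt
  have h3 : HasMFDerivAt 𝓘(ℝ, Model n) 𝓘(ℝ, Model n) (heightMap p l ν φ) y _ := h1.add h2
  exact congrArg (fun T : Model n →L[ℝ] Model n => T v) h3.mfderiv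

/-- Replacing the `ν`-coordinate of the chart by the height `t` gives local coordinates on `M`. The
replaced coordinate, as a function of the new ones, is constant in `t`, and its graph over `ker l`
is the base `L` of the cylinder. -/
theorem IsImmersedHypersurface.exists_isLocallyCylinder [IsManifold 𝓘(ℝ, Model n) ∞ M]
    (hφ : IsImmersedHypersurface n I φ)
    (hvert : ∀ y, ∃ u : TangentSpace 𝓘(ℝ, Model n) y, dTime φ y u = 1 ∧ dSpace φ y u = 0) {x : M} {l : Model n →L[ℝ] ℝ}
    {ν : Model n} (hν : l ν = 1)
    (hl : ∀ v, l (mfderiv 𝓘(ℝ, Model n) 𝓘(ℝ, Model n) (chartAt (Model n) (φ x).2) (φ x).2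
        (dSpace φ x v)) = 0) :
    ∃ (U : Set M) (L : Set P) (W : Set (ℝ × P)),
      IsOpen U ∧ x ∈ U ∧ InjOn φ U ∧ IsHypersurface n L ∧ IsOpen W ∧ φ '' U = W ∩ (I ×ˢ L) := by
  let p := (φ x).2
  let c := chartAt (Model n) p
  let F := heightMap p l ν φ
  let O : Set M := (fun y => (φ y).2) ⁻¹' c.source
  have hO : IsOpen O := c.open_source.preimage hφ.contMDiff_snd.continuous
  have hxO : x ∈ O := mem_chart_source (Model n) p
  have hc := mdifferentiable_chart (I := 𝓘(ℝ, Model n)) p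
  have hF : ContMDiffOn 𝓘(ℝ, Model n) 𝓘(ℝ, Model n) ∞ F O := hφ.contMDiffOn_heightMap p l ν
  -- Applying `l` to `dF v = 0` gives `dTime v = 0`. Then the chart image of `dSpace v` has zero
  -- component in `ker l`, and zero `l`-value by `hl`.
  have hinj : Function.Injective (mfderiv 𝓘(ℝ, Model n) 𝓘(ℝ, Model n) F x) := by
    rw [injective_iff_map_eq_zero]
    intro v hv
    have hv' := (hφ.mfderiv_heightMap l ν hxO v).symm.trans hv
    have h1 : dTime φ x v = 0 := by
      rw [← apply_projKer_add hν (mfderiv 𝓘(ℝ, Model n) 𝓘(ℝ, Model n) c p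
        (dSpace φ x v)) (dTime φ x v), hv']
      exact map_zero l
    have h2 : mfderiv 𝓘(ℝ, Model n) 𝓘(ℝ, Model n) c p (dSpace φ x v) = 0 := by
      rw [h1, zero_smul, add_zero] at hv'
      have h3 := projKer_add (l := l) (ν := ν) (mfderiv 𝓘(ℝ, Model n) 𝓘(ℝ, Model n) c p
        (dSpace φ x v))
      rw [hv', hl v, zero_smul] at h3
      exact h3.symm.trans (add_zero 0)
    exact hφ.eq_zero h1 (hc.mfderiv_injective hxO (h2.trans (map_zero _).symm))
  obtain ⟨e, hxe, heO, he, hesymm⟩ := hF.exists_openPartialHomeomorph hO hxO hinj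
  let z₀ := F x
  obtain ⟨ε, hε, hbox⟩ := exists_box_subset (l := l) (ν := ν) e.open_target
    (show z₀ ∈ e.target from (congrArg (· ∈ e.target) (he hxe)).mp (e.map_source hxe))
  let h : Model n → ℝ := fun z => l (c (φ (e.symm z)).2)
  have hsymmO : ∀ z ∈ e.target, e.symm z ∈ O := fun z hz => heO (e.map_target hz)
  have hFsymm : ∀ z ∈ e.target, F (e.symm z) = z := fun z hz =>
    (he (e.map_target hz)).symm.trans (e.right_inv hz)
  have hsymmF : ∀ y ∈ e.source, e.symm (F y) = y := fun y hy => by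
    rw [← he hy, e.left_inv hy]
  have hh : ContDiffOn ℝ ∞ h e.target := by
    rw [← contMDiffOn_iff_contDiffOn]
    exact l.contDiff.contMDiff.comp_contMDiffOn
      ((hφ.contMDiffOn_chart p).comp hesymm hsymmO)
  have hhd : ∀ z ∈ e.target, DifferentiableAt ℝ h z := fun z hz =>
    (hh.contDiffAt (e.open_target.mem_nhds hz)).differentiableAt (by simp)
  -- The vertical vector `u` satisfies `dF u = ν`, while `h ∘ F` depends on the space component of
  -- `φ` only, whose differential kills `u`.
  have hhν : ∀ z ∈ e.target, fderiv ℝ h z ν = 0 := by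
    intro z hz
    obtain ⟨y, hy, rfl⟩ : ∃ y ∈ e.source, F y = z := ⟨_, e.map_target hz, hFsymm z hz⟩
    obtain ⟨u, hu1, hu2⟩ := hvert y
    have hyO := heO hy
    have hFu : mfderiv 𝓘(ℝ, Model n) 𝓘(ℝ, Model n) F y u = ν := by
      refine (hφ.mfderiv_heightMap l ν hyO u).trans ?_
      rw [hu1, hu2, map_zero, one_smul]
      exact (congrArg (· + ν) (map_zero (projKer l ν))).trans (zero_add ν)
    have hFd : MDifferentiableAt 𝓘(ℝ, Model n) 𝓘(ℝ, Model n) F y :=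
      (hF.contMDiffAt (hO.mem_nhds hyO)).mdifferentiableAt (by simp)
    have h1 := (hhd _ hz).hasFDerivAt.hasMFDerivAt.comp y hFd.hasMFDerivAt
    have h2 := l.hasMFDerivAt.comp y (hφ.hasMFDerivAt_chart hyO)
    have h3 : h ∘ F =ᶠ[nhds y] l ∘ fun y => c (φ y).2 := by
      filter_upwards [e.open_source.mem_nhds hy] with w hw
      simp only [Function.comp_apply, h, hsymmF w hw]
    have h4 := congrArg (fun T : Model n →L[ℝ] ℝ => T u)
      (hasMFDerivAt_unique h1 (h2.congr_of_eventuallyEq h3))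
    calc fderiv ℝ h (F y) ν = fderiv ℝ h (F y) (mfderiv 𝓘(ℝ, Model n) 𝓘(ℝ, Model n) F y u) := by
          rw [hFu]
      _ = l (mfderiv 𝓘(ℝ, Model n) 𝓘(ℝ, Model n) c (φ y).2 (dSpace φ y u)) := h4
      _ = 0 := by
          rw [hu2, map_zero]
          exact map_zero l
  have hconst : ∀ z ∈ box l ν z₀ ε, h z = h (projKer l ν z + l z₀ • ν) := fun z hz =>
    eq_of_fderiv_apply_eq_zero hν hε (fun y hy => hhd y (hbox hy)) (fun y hy => hhν y (hbox hy)) hz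
  have hUopen : IsOpen (e.source ∩ F ⁻¹' box l ν z₀ ε) :=
    (hF.continuousOn.mono heO).isOpen_inter_preimage e.open_source (isOpen_box z₀ ε)
  have hW : IsOpen {w : ℝ × P | |w.1 - l z₀| < ε} := by
    have : Continuous fun w : ℝ × P => |w.1 - l z₀| := by fun_prop
    exact isOpen_lt this continuous_const
  refine ⟨e.source ∩ F ⁻¹' box l ν z₀ ε, _, {w | |w.1 - l z₀| < ε}, hUopen,
    ⟨hxe, self_mem_box _ hε⟩, ?_, isHypersurface_graph p hν hε (hh.mono hbox), hW, ?_⟩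
  · intro y hy w hw hyw
    have : F y = F w := by simp only [F, heightMap, hyw]
    rw [← hsymmF y hy.1, this, hsymmF w hw.1]
  · ext ⟨t, q⟩
    constructor
    · rintro ⟨y, hy, hyt⟩
      have hb : |l (F y) - l z₀| < ε ∧ ‖projKer l ν (F y) - projKer l ν z₀‖ < ε := hy.2
      have hcst := hconst _ hy.2
      rw [apply_heightMap p hν, projKer_heightMap p hν] at hb
      rw [projKer_heightMap p hν] at hcst
      simp only [h, hsymmF y hy.1] at hcst
      rw [← hyt]
      exact ⟨hb.1, hφ.mem y, ⟨heO hy.1, hb.2⟩, hcst⟩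
    · rintro ⟨ht, -, ⟨hq, hqb⟩, hlq⟩
      -- The preimage of `(t, q)` is the point of `M` with height `t` and the `ker l` component of
      -- `c q`; its `l`-coordinate is that of `c q` because `h` is constant along `ν`.
      have hz : projKer l ν (c q) + t • ν ∈ box l ν z₀ ε := projKer_add_mem_box hν ht hqb
      have hcst := hconst _ hz
      set z := projKer l ν (c q) + t • ν with hzdef
      have hFz := hFsymm z (hbox hz)
      have hsz := hsymmF _ (e.map_target (hbox hz))
      refine ⟨e.symm z, ⟨e.map_target (hbox hz), ?_⟩, ?_⟩
      · rw [mem_preimage, hFz]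
        exact hz
      · have h1 : (φ (e.symm z)).1 = t := by
          rw [← apply_heightMap (φ := φ) p hν]
          exact (congrArg l hFz).trans (apply_projKer_add hν _ _)
        have h2 : projKer l ν (c (φ (e.symm z)).2) = projKer l ν (c q) := by
          rw [← projKer_heightMap (φ := φ) p hν]
          exact (congrArg (projKer l ν) hFz).trans (projKer_projKer_add hν _ _)
        have h3 : l (c (φ (e.symm z)).2) = l (c q) := by
          rw [hzdef, projKer_projKer_add hν] at hcst
          exact hcst.trans hlq.symm
        have h4 : c (φ (e.symm z)).2 = c q := by
          rw [← projKer_add (l := l) (ν := ν) (c (φ (e.symm z)).2), h2, h3, projKer_add]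
        exact Prod.ext h1 (c.injOn (hsymmO z (hbox hz)) hq h4)

end Vertical

/-! ### Horizontal normals give cylinders. -/

section Normal

variable {n : ℕ} {P : Type*} [TopologicalSpace P] [ChartedSpace (Model n) P]
  [RiemannianBundle (fun p : P ↦ TangentSpace 𝓘(ℝ, Model n) p)]
  [IsManifold 𝓘(ℝ, Model n) ∞ P] {M : Type*} [TopologicalSpace M]
  [ChartedSpace (Model n) M] {I : Set ℝ} {ρ : ℝ → ℝ} {φ : M → ℝ × P}
  {ξ : ∀ x : M, TangentAmbient n (φ x)}

theorem IsUnitNormalField.isLocallyCylinder [IsManifold 𝓘(ℝ, Model n) ∞ M]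
    (hφ : IsImmersedHypersurface n I φ) (hρ : ∀ t ∈ I, 0 < ρ t) (hξ : IsUnitNormalField ρ φ ξ)
    (h0 : ∀ y, timePart (ξ y) = 0) : IsLocallyCylinder n I φ := by
  intro x
  have hc := mdifferentiable_chart (I := 𝓘(ℝ, Model n)) (φ x).2
  let A := hc.mfderiv (mem_chart_source (Model n) (φ x).2)
  have hξx : spacePart (ξ x) ≠ 0 := by
    intro h
    have := hξ.time_space x
    rw [h0, h] at this
    norm_num at this
  -- The covector `⟨ζ, ·⟩` transported to the chart; `ν` below is the image of `ζ / |ζ|²`, scaled so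
  -- that `l ν = 1`.
  let l' : Model n →ₗ[ℝ] ℝ :=
    (innerSL ℝ (spacePart (ξ x))).toLinearMap ∘ₗ A.symm.toLinearEquiv.toLinearMap
  have hl' : ∀ w, l' (A w) = inner ℝ (spacePart (ξ x)) w := fun w =>
    congrArg (inner ℝ (spacePart (ξ x))) (A.symm_apply_apply w)
  let s : ℝ := (inner ℝ (spacePart (ξ x)) (spacePart (ξ x)))⁻¹
  refine hφ.exists_isLocallyCylinder (x := x) (l := LinearMap.toContinuousLinearMap l')
    (ν := A (s • spacePart (ξ x))) ?_ ?_ ?_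
  · intro y
    exact hξ.exists_tangent hφ (by rw [h0, inner_zero_right]; simp)
  · refine (hl' _).trans ?_
    rw [real_inner_smul_right]
    exact inv_mul_cancel₀ (inner_self_ne_zero.2 hξx)
  · intro v
    refine (hl' _).trans ?_
    have h := hξ.normal_eq hφ x v
    rw [h0, zero_mul, zero_add] at h
    exact (mul_eq_zero.1 h).resolve_left (pow_ne_zero 2 (hρ _ (hφ.mem x)).ne')

end Normal

end WarpedProduct

/-! ### The classification. -/

theorem mainTheorem1 {n : ℕ}
    {P : Type*} [TopologicalSpace P] [ChartedSpace (WarpedProduct.Model n) P]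
    [IsManifold 𝓘(ℝ, WarpedProduct.Model n) ∞ P]
    [RiemannianBundle (fun p : P ↦ TangentSpace 𝓘(ℝ, WarpedProduct.Model n) p)]
    [IsContMDiffRiemannianBundle 𝓘(ℝ, WarpedProduct.Model n) ∞ (WarpedProduct.Model n)
      (fun p : P ↦ TangentSpace 𝓘(ℝ, WarpedProduct.Model n) p)]
    {M : Type*} [TopologicalSpace M] [ChartedSpace (WarpedProduct.Model n) M]
    [IsManifold 𝓘(ℝ, WarpedProduct.Model n) ∞ M] [ConnectedSpace M]
    {I : Set ℝ} (hI : IsOpen I) (hI' : I.OrdConnected)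
    {ρ : ℝ → ℝ} (hρ : ContDiffOn ℝ ∞ ρ I) (hρ_pos : ∀ t ∈ I, 0 < ρ t)
    {φ : M → ℝ × P} (hφ : WarpedProduct.IsImmersedHypersurface n I φ)
    (hor : WarpedProduct.IsOrientableHypersurface n ρ φ) :
    (WarpedProduct.IsConstantAngleHypersurface n ρ φ ↔
      WarpedProduct.IsLocallyCylinder n I φ ∨
        ∃ C : ℝ, WarpedProduct.IsLocallyTransnormalGraph n I ρ C φ) ∧
    (WarpedProduct.HasConstantAngle n ρ φ (Real.pi / 2) ↔
      WarpedProduct.IsLocallyCylinder n I φ) ∧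
    (∀ θ : ℝ, 0 ≤ θ → θ < Real.pi / 2 →
      (WarpedProduct.HasConstantAngle n ρ φ θ ↔
        WarpedProduct.IsLocallyTransnormalGraph n I ρ (Real.tan θ) φ)) := by
  obtain ⟨ξ₀, hξ₀⟩ := hor
  have hπ := Real.pi_pos
  have hcyl : WarpedProduct.HasConstantAngle n ρ φ (Real.pi / 2) ↔
      WarpedProduct.IsLocallyCylinder n I φ := by
    constructor
    · rintro ⟨ξ, hξ, h⟩
      refine hξ.isLocallyCylinder hφ hρ_pos fun y => ?_
      rw [(hξ.warpedAngle_eq_iff y (by linarith) (by linarith)).1 (h y), Real.cos_pi_div_two]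
    · intro h
      refine ⟨ξ₀, hξ₀, fun y => (hξ₀.warpedAngle_eq_iff y (by linarith) (by linarith)).2 ?_⟩
      rw [hξ₀.timePart_eq_zero_of_isLocallyCylinder hφ h, Real.cos_pi_div_two]
  have hgraph : ∀ θ : ℝ, 0 ≤ θ → θ < Real.pi / 2 →
      (WarpedProduct.HasConstantAngle n ρ φ θ ↔
        WarpedProduct.IsLocallyTransnormalGraph n I ρ (Real.tan θ) φ) := by
    intro θ h0 hθ
    constructor
    · rintro ⟨ξ, hξ, h⟩
      exact hξ.isLocallyTransnormalGraph hφ hρ_pos h0 hθ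
        fun y => (hξ.warpedAngle_eq_iff y h0 (by linarith)).1 (h y)
    · exact hξ₀.hasConstantAngle_of_isLocallyTransnormalGraph hφ hρ_pos h0 hθ
  refine ⟨⟨?_, ?_⟩, hcyl, hgraph⟩
  · rintro ⟨θ, ξ, hξ, h⟩
    obtain ⟨x⟩ : Nonempty M := inferInstance
    have h0 : 0 ≤ θ := h x ▸ Real.arccos_nonneg _
    have hθπ : θ ≤ Real.pi := h x ▸ Real.arccos_le_pi _
    have hcos : ∀ y, WarpedProduct.timePart (ξ y) = Real.cos θ := fun y =>
      (hξ.warpedAngle_eq_iff y h0 hθπ).1 (h y)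
    rcases lt_trichotomy θ (Real.pi / 2) with hlt | rfl | hgt
    · exact Or.inr ⟨_, (hgraph θ h0 hlt).1 ⟨ξ, hξ, h⟩⟩
    · exact Or.inl (hcyl.1 ⟨ξ, hξ, h⟩)
    -- For an obtuse angle, `-ξ` makes the acute angle `π - θ` with `∂_t`.
    · refine Or.inr ⟨_, hξ.neg.isLocallyTransnormalGraph hφ hρ_pos (θ := Real.pi - θ)
        (by linarith) (by linarith) fun y => ?_⟩
      rw [Real.cos_pi_sub, ← hcos]
      rfl
  · rintro (h | ⟨C, h⟩)
    · exact ⟨_, hcyl.2 h⟩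
    · obtain ⟨x⟩ : Nonempty M := inferInstance
      -- `C ≥ 0` places `arctan C` in `[0, π / 2)`, where the graph criterion applies.
      have hC := (hξ₀.timePart_sq_of_isLocallyTransnormalGraph hφ hρ_pos h x).1
      refine ⟨Real.arctan C, (hgraph _ (Real.arctan_nonneg.2 hC) (Real.arctan_lt_pi_div_two C)).2 ?_⟩
      rwa [Real.tan_arctan]
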